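/- Let $M=(|M|,\mathcal O_M)$ be a (real, smooth) supermanifold of dimension $n|m$: a Hausdorff second countable space with a sheaf of super $\mathbf R$-algebras locally isomorphic to $(\mathbf R^n,\ C^\infty\otimes\Lambda_{\mathbf R}[\xi_1,\dots,\xi_m])$. Let $\mathcal T_M(U)=\mathrm{Der}(\mathcal O_M(U))$ be its tangent sheaf, and write $|\cdot|\in\mathbf Z/2$ for parity. Let $\langle\cdot,\cdot\rangle$ be a graded Riemannian metric on $M$, i.e. an even, graded-symmetric ($\langle X,Y\rangle=(-1)^{|X||Y|}\langle Y,X\rangle$), non-degenerate, $\mathcal O_M$-linear morphism of sheaves $\mathcal T_M\otimes\mathcal T_M\to\mathcal O_M$; non-degenerate means that it induces an isomorphism of $\mathcal T_M$ with its dual $\Omega^1_M$. Let $\nabla$ be its Levi-Civita connection, i.e. the connection on $\mathcal T_M$ with $$\nabla_XY-(-1)^{|X||Y|}\nabla_YX-[X,Y]=0,\qquad X\langle Y,Z\rangle=\langle\nabla_XY,Z\rangle+(-1)^{|X||Y|}\langle Y,\nabla_XZ\rangle,$$ where $[X,Y]=XY-(-1)^{|X||Y|}YX$, and let $$R(X,Y)Z=\nabla_X\nabla_YZ-(-1)^{|X||Y|}\nabla_Y\nabla_XZ-\nabla_{[X,Y]}Z$$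 be its curvature. Then for every open set $U\subseteq|M|$ and all homogeneous vector fields $X,Y,Z,W$ on $U$: $$\langle R(X,Y)Z,W\rangle=-(-1)^{|X||Y|}\langle R(Y,X)Z,W\rangle=-(-1)^{|Z||W|}\langle R(X,Y)W,Z\rangle,$$ $$\langle R(X,Y)Z,W\rangle=(-1)^{(|X|+|Y|)(|Z|+|W|)}\langle R(Z,W)X,Y\rangle,$$ $$R(X,Y)Z+(-1)^{|Z|(|X|+|Y|)}R(Z,X)Y+(-1)^{|X|(|Y|+|Z|)}R(Y,Z)X=0.$$ -/

import Mathlib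

open TopologicalSpace Opposite CategoryTheory
open scoped Manifold ContDiff TensorProduct

noncomputable section

namespace SuperGeometry

universe u

/-! ### Superalgebras and their derivations

A super `ℝ`-algebra is an `ℝ`-algebra `A` with a grading `𝒜` by `ZMod 2`. The sign
`(-1)^{|a||b|}` is written `(-1 : ℤˣ) ^ (i * j)`, where `i`, `j` are the parities in `ZMod 2`. -/

theorem zmod_two_cases : ∀ i : ZMod 2, i = 0 ∨ i = 1 := by decide

section Superalgebra

variable {A : Type u} [Ring A] [Algebra ℝ A] (𝒜 : ZMod 2 → Submodule ℝ A)

/-- `ab = (-1)^{|a||b|} ba` for homogeneous `a`, `b`. -/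
def IsSupercommutative : Prop :=
  ∀ i j : ZMod 2, ∀ a ∈ 𝒜 i, ∀ b ∈ 𝒜 j, a * b = (-1 : ℤˣ) ^ (i * j) • (b * a)

/-- The homogeneous derivations of parity `i`: the endomorphisms `D` of parity `i` with
`D (a b) = D a * b + (-1)^{|D||a|} a * D b` for homogeneous `a`. -/
def homDer (i : ZMod 2) : Submodule ℝ (Module.End ℝ A) where
  carrier := {D | (∀ j, ∀ a ∈ 𝒜 j, D a ∈ 𝒜 (i + j)) ∧
    ∀ j, ∀ a ∈ 𝒜 j, ∀ b, D (a * b) = D a * b + (-1 : ℤˣ) ^ (i * j) • (a * D b)}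
  add_mem' := by
    rintro D E ⟨hD, hD'⟩ ⟨hE, hE'⟩
    refine ⟨fun j a ha => add_mem (hD j a ha) (hE j a ha), fun j a ha b => ?_⟩
    simp only [LinearMap.add_apply, hD' j a ha, hE' j a ha, add_mul, mul_add, smul_add]
    abel
  zero_mem' := by
    refine ⟨fun j a _ => zero_mem _, fun j a _ b => ?_⟩
    simp
  smul_mem' := by
    rintro c D ⟨hD, hD'⟩
    refine ⟨fun j a ha => Submodule.smul_mem _ _ (hD j a ha), fun j a ha b => ?_⟩
    simp only [LinearMap.smul_apply, hD' j a ha, smul_add, smul_mul_assoc, mul_smul_comm]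
    rw [smul_comm c]

theorem superCommutator_mem {i j : ZMod 2} {D E : Module.End ℝ A}
    (hD : D ∈ homDer 𝒜 i) (hE : E ∈ homDer 𝒜 j) :
    D * E - (-1 : ℤˣ) ^ (i * j) • (E * D) ∈ homDer 𝒜 (i + j) := by
  refine ⟨fun k a ha => ?_, fun k a ha b => ?_⟩
  · have h1 := hD.1 _ _ (hE.1 k a ha)
    have h2 := hE.1 _ _ (hD.1 k a ha)
    rw [← add_assoc] at h1
    rw [← add_assoc, add_comm j i] at h2
    rw [LinearMap.sub_apply, Units.smul_def, LinearMap.smul_apply]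
    exact sub_mem h1 (zsmul_mem h2 _)
  · have hi : i = 0 ∨ i = 1 := zmod_two_cases i
    have hj : j = 0 ∨ j = 1 := zmod_two_cases j
    have hk : k = 0 ∨ k = 1 := zmod_two_cases k
    have e11 : (1 + 1 : ZMod 2) = 0 := rfl
    rw [LinearMap.sub_apply, LinearMap.sub_apply, LinearMap.sub_apply]
    simp only [Units.smul_def, LinearMap.smul_apply, Module.End.mul_apply, hE.2 k a ha, hD.2 k a ha,
      map_add, map_zsmul, hD.2 _ _ (hE.1 k a ha), hE.2 _ _ (hD.1 k a ha)]
    rcases hi with rfl | rfl <;> rcases hj with rfl | rfl <;> rcases hk with rfl | rfl <;>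
      simp [e11, mul_sub, sub_mul, mul_add, add_mul] <;> abel

variable [GradedAlgebra 𝒜]

/-- The homogeneous component of parity `i` of an endomorphism of a super vector space. -/
def endPart (i : ZMod 2) : Module.End ℝ A →ₗ[ℝ] Module.End ℝ A where
  toFun φ := ∑ j : ZMod 2, GradedAlgebra.proj 𝒜 (i + j) ∘ₗ φ ∘ₗ GradedAlgebra.proj 𝒜 j
  map_add' φ ψ := by
    simp only [LinearMap.add_comp, LinearMap.comp_add, Finset.sum_add_distrib]
  map_smul' c φ := by
    simp only [LinearMap.smul_comp, LinearMap.comp_smul, Finset.smul_sum, RingHom.id_apply]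

theorem endPart_apply (i : ZMod 2) (φ : Module.End ℝ A) (a : A) :
    endPart 𝒜 i φ a = ∑ j : ZMod 2,
      GradedAlgebra.proj 𝒜 (i + j) (φ (GradedAlgebra.proj 𝒜 j a)) := by
  simp [endPart]

theorem proj_of_mem {i : ZMod 2} {a : A} (ha : a ∈ 𝒜 i) (j : ZMod 2) :
    GradedAlgebra.proj 𝒜 j a = if j = i then a else 0 := by
  rw [GradedAlgebra.proj_apply]
  split_ifs with h
  · subst h
    exact DirectSum.decompose_of_mem_same 𝒜 ha
  · exact DirectSum.decompose_of_mem_ne 𝒜 ha (Ne.symm h)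

theorem sum_proj (a : A) : ∑ j : ZMod 2, GradedAlgebra.proj 𝒜 j a = a := by
  classical
  simp only [GradedAlgebra.proj_apply]
  conv_rhs => rw [← DirectSum.sum_support_decompose 𝒜 a]
  refine (Finset.sum_subset (Finset.subset_univ _) ?_).symm
  intro j _ hj
  rw [DFinsupp.notMem_support_iff] at hj
  rw [hj, ZeroMemClass.coe_zero]

theorem endPart_of_homogeneous {i : ZMod 2} {φ : Module.End ℝ A}
    (hφ : ∀ j, ∀ a ∈ 𝒜 j, φ a ∈ 𝒜 (i + j)) (k : ZMod 2) :
    endPart 𝒜 k φ = if k = i then φ else 0 := by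
  ext a
  have h : ∀ j, GradedAlgebra.proj 𝒜 (k + j) (φ (GradedAlgebra.proj 𝒜 j a)) =
      if k = i then φ (GradedAlgebra.proj 𝒜 j a) else 0 := by
    intro j
    rw [proj_of_mem 𝒜 (hφ j _ (by rw [GradedAlgebra.proj_apply]; exact SetLike.coe_mem _))]
    simp
  rw [endPart_apply, Finset.sum_congr rfl fun j _ => h j]
  split_ifs with hk
  · rw [← map_sum, sum_proj]
  · simp

theorem sum_endPart (φ : Module.End ℝ A) : ∑ i : ZMod 2, endPart 𝒜 i φ = φ := by
  ext a
  rw [LinearMap.sum_apply]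
  simp only [endPart_apply]
  rw [Finset.sum_comm]
  have h : ∀ j : ZMod 2, ∑ i : ZMod 2,
      GradedAlgebra.proj 𝒜 (i + j) (φ (GradedAlgebra.proj 𝒜 j a)) =
        φ (GradedAlgebra.proj 𝒜 j a) := by
    intro j
    exact (Equiv.sum_comp (Equiv.addRight j)
      (fun k => GradedAlgebra.proj 𝒜 k (φ (GradedAlgebra.proj 𝒜 j a)))).trans (sum_proj 𝒜 _)
  rw [Finset.sum_congr rfl fun j _ => h j, ← map_sum, sum_proj]

theorem endPart_mem_homDer {i : ZMod 2} {D : Module.End ℝ A} (hD : D ∈ homDer 𝒜 i)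
    (k : ZMod 2) : endPart 𝒜 k D ∈ homDer 𝒜 k := by
  rw [endPart_of_homogeneous 𝒜 hD.1]
  split_ifs with h
  · rwa [h]
  · exact zero_mem _

variable {𝒜} in
theorem smul_mem_homDer (h𝒜 : IsSupercommutative 𝒜) {k i : ZMod 2} {a : A} (ha : a ∈ 𝒜 k)
    {D : Module.End ℝ A} (hD : D ∈ homDer 𝒜 i) : a • D ∈ homDer 𝒜 (k + i) := by
  refine ⟨fun j b hb => ?_, fun j b hb c => ?_⟩
  · rw [LinearMap.smul_apply, smul_eq_mul, add_assoc]
    exact SetLike.mul_mem_graded ha (hD.1 j b hb)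
  · simp only [LinearMap.smul_apply, smul_eq_mul, hD.2 j b hb c, mul_add, mul_smul_comm]
    rw [mul_assoc, ← mul_assoc a b, h𝒜 k j a ha b hb, add_mul, uzpow_add, mul_smul, smul_mul_assoc,
      mul_assoc, smul_comm]

/-- The derivations of a supercommutative superalgebra `A`: the endomorphisms all of whose
homogeneous components are homogeneous derivations. They form an `A`-module via
`(a • D) b = a * D b`. -/
def der (h𝒜 : IsSupercommutative 𝒜) : Submodule A (Module.End ℝ A) where
  carrier := {D | ∀ i, endPart 𝒜 i D ∈ homDer 𝒜 i}
  add_mem' := by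
    intro D E hD hE i
    rw [map_add]
    exact add_mem (hD i) (hE i)
  zero_mem' := by
    intro i
    rw [map_zero]
    exact zero_mem _
  smul_mem' := by
    intro a D hD i
    rw [← sum_proj 𝒜 a, ← sum_endPart 𝒜 D, Finset.sum_smul, map_sum]
    refine sum_mem fun k _ => ?_
    rw [Finset.smul_sum, map_sum]
    refine sum_mem fun j _ => ?_
    have hk : GradedAlgebra.proj 𝒜 k a ∈ 𝒜 k := by
      rw [GradedAlgebra.proj_apply]
      exact SetLike.coe_mem _
    exact endPart_mem_homDer 𝒜 (smul_mem_homDer h𝒜 hk (hD j)) i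

/-- The type of derivations of a supercommutative superalgebra. -/
def Der (h𝒜 : IsSupercommutative 𝒜) : Type u := der 𝒜 h𝒜

instance (h𝒜 : IsSupercommutative 𝒜) : AddCommGroup (Der 𝒜 h𝒜) :=
  inferInstanceAs (AddCommGroup (der 𝒜 h𝒜))

instance (h𝒜 : IsSupercommutative 𝒜) : Module A (Der 𝒜 h𝒜) :=
  inferInstanceAs (Module A (der 𝒜 h𝒜))

instance (h𝒜 : IsSupercommutative 𝒜) : Module ℝ (Der 𝒜 h𝒜) :=
  inferInstanceAs (Module ℝ (der 𝒜 h𝒜))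

instance (h𝒜 : IsSupercommutative 𝒜) : IsScalarTower ℝ A (Der 𝒜 h𝒜) :=
  inferInstanceAs (IsScalarTower ℝ A (der 𝒜 h𝒜))

instance (h𝒜 : IsSupercommutative 𝒜) : SMulCommClass ℝ A (Der 𝒜 h𝒜) where
  smul_comm c a D := Subtype.ext (smul_comm c a D.1)

theorem homDer_le_der (h𝒜 : IsSupercommutative 𝒜) {i : ZMod 2} {D : Module.End ℝ A}
    (hD : D ∈ homDer 𝒜 i) : D ∈ der 𝒜 h𝒜 :=
  fun k => endPart_mem_homDer 𝒜 hD k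

end Superalgebra
/-! ### The local model -/

section Model

theorem exterior_ι_mul {V : Type*} [AddCommGroup V] [Module ℝ V] (v : V) (j : ZMod 2)
    (b : ExteriorAlgebra ℝ V) (hb : b ∈ CliffordAlgebra.evenOdd (0 : QuadraticForm ℝ V) j) :
    ExteriorAlgebra.ι ℝ v * b = (-1 : ℤˣ) ^ j • (b * ExteriorAlgebra.ι ℝ v) := by
  have hsw : ∀ x y : V, ExteriorAlgebra.ι ℝ x * ExteriorAlgebra.ι ℝ y =
      -(ExteriorAlgebra.ι ℝ y * ExteriorAlgebra.ι ℝ x) :=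
    fun x y => eq_neg_of_add_eq_zero_left (ExteriorAlgebra.ι_add_mul_swap x y)
  induction b, hb using CliffordAlgebra.evenOdd_induction with
  | range_ι_pow w h =>
    rcases zmod_two_cases j with rfl | rfl
    · obtain ⟨r, rfl⟩ := Submodule.mem_one.1 (by simpa using h)
      simp [Algebra.commutes]
    · have h' : w ∈ LinearMap.range (CliffordAlgebra.ι (0 : QuadraticForm ℝ V)) := by
        simpa [ZMod.val_one] using h
      obtain ⟨y, rfl⟩ := h'
      simpa using hsw v y
  | add x y hx hy ihx ihy => rw [mul_add, add_mul, smul_add, ihx, ihy]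
  | ι_mul_ι_mul m₁ m₂ x hx ih =>
    change ExteriorAlgebra.ι ℝ v * (ExteriorAlgebra.ι ℝ m₁ * ExteriorAlgebra.ι ℝ m₂ * x) =
      (-1 : ℤˣ) ^ j • (ExteriorAlgebra.ι ℝ m₁ * ExteriorAlgebra.ι ℝ m₂ * x * ExteriorAlgebra.ι ℝ v)
    rw [mul_assoc (ExteriorAlgebra.ι ℝ m₁ * ExteriorAlgebra.ι ℝ m₂), ← mul_smul_comm, ← ih,
      ← mul_assoc, ← mul_assoc, ← mul_assoc, hsw v m₁, neg_mul, mul_assoc (ExteriorAlgebra.ι ℝ m₁),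
      hsw v m₂, mul_neg, neg_neg, ← mul_assoc]

theorem exterior_supercommutative (V : Type*) [AddCommGroup V] [Module ℝ V] :
    IsSupercommutative (A := ExteriorAlgebra ℝ V)
      (CliffordAlgebra.evenOdd (0 : QuadraticForm ℝ V)) := by
  intro i j a ha b hb
  induction a, ha using CliffordAlgebra.evenOdd_induction with
  | range_ι_pow w h =>
    rcases zmod_two_cases i with rfl | rfl
    · obtain ⟨r, rfl⟩ := Submodule.mem_one.1 (by simpa using h)
      simp [Algebra.commutes]
    · have h' : w ∈ LinearMap.range (CliffordAlgebra.ι (0 : QuadraticForm ℝ V)) := by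
        simpa [ZMod.val_one] using h
      obtain ⟨y, rfl⟩ := h'
      rw [one_mul]
      exact exterior_ι_mul y j b hb
  | add x y hx hy ihx ihy => rw [mul_add, add_mul, smul_add, ihx, ihy]
  | ι_mul_ι_mul m₁ m₂ x hx ih =>
    change ExteriorAlgebra.ι ℝ m₁ * ExteriorAlgebra.ι ℝ m₂ * x * b =
      (-1 : ℤˣ) ^ (i * j) • (b * (ExteriorAlgebra.ι ℝ m₁ * ExteriorAlgebra.ι ℝ m₂ * x))
    have h2 : ExteriorAlgebra.ι ℝ m₁ * ExteriorAlgebra.ι ℝ m₂ * b =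
        b * (ExteriorAlgebra.ι ℝ m₁ * ExteriorAlgebra.ι ℝ m₂) := by
      rw [mul_assoc, exterior_ι_mul m₂ j b hb, mul_smul_comm, ← mul_assoc,
        exterior_ι_mul m₁ j b hb, smul_mul_assoc, smul_smul, ← uzpow_add, CharTwo.add_self_eq_zero,
        uzpow_zero, one_smul, mul_assoc]
    rw [mul_assoc, ih, mul_smul_comm, ← mul_assoc, h2, mul_assoc]

variable (n m : ℕ)

/-- Smooth real functions on an open subset of `ℝⁿ`. -/
abbrev SmoothFun {n : ℕ} (V : Opens (EuclideanSpace ℝ (Fin n))) : Type :=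
  C^∞⟮𝓘(ℝ, EuclideanSpace ℝ (Fin n)), V; 𝓘(ℝ, ℝ), ℝ⟯

/-- The exterior algebra `Λ[ξ₁, …, ξₘ]`. -/
abbrev OddAlgebra : Type := ExteriorAlgebra ℝ (Fin m → ℝ)

/-- Sections over `V` of the structure sheaf `C^∞ ⊗ Λ[ξ₁, …, ξₘ]` of `ℝ^{n|m}`. -/
abbrev Model {n : ℕ} (m : ℕ) (V : Opens (EuclideanSpace ℝ (Fin n))) : Type :=
  SmoothFun V ⊗[ℝ] OddAlgebra m

/-- The parity of `C^∞ ⊗ Λ`: smooth functions are even, and `Λ` is graded by parity of degree. -/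
def modelParity {n : ℕ} (m : ℕ) (V : Opens (EuclideanSpace ℝ (Fin n))) (i : ZMod 2) :
    Submodule ℝ (Model m V) :=
  Submodule.span ℝ {x | ∃ (f : SmoothFun V) (s : OddAlgebra m),
    s ∈ CliffordAlgebra.evenOdd (0 : QuadraticForm ℝ (Fin m → ℝ)) i ∧ f ⊗ₜ[ℝ] s = x}

/-- Restriction of smooth functions. -/
def smoothRes {n : ℕ} {V W : Opens (EuclideanSpace ℝ (Fin n))} (h : W ≤ V) :
    SmoothFun V →ₐ[ℝ] SmoothFun W :=
  { ContMDiffMap.restrictRingHom 𝓘(ℝ, EuclideanSpace ℝ (Fin n)) 𝓘(ℝ, ℝ) ℝ h with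
    commutes' := fun _ => rfl }

/-- Restriction in the structure sheaf of `ℝ^{n|m}`. -/
def modelRes {n : ℕ} (m : ℕ) {V W : Opens (EuclideanSpace ℝ (Fin n))} (h : W ≤ V) :
    Model m V →ₐ[ℝ] Model m W :=
  Algebra.TensorProduct.map (smoothRes h) (AlgHom.id ℝ (OddAlgebra m))

theorem model_supercommutative {n : ℕ} (m : ℕ) (V : Opens (EuclideanSpace ℝ (Fin n))) :
    IsSupercommutative (modelParity m V) := by
  intro i j a ha b hb
  induction ha using Submodule.span_induction with
  | mem x hx =>
    obtain ⟨f, s, hs, rfl⟩ := hx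
    induction hb using Submodule.span_induction with
    | mem y hy =>
      obtain ⟨g, t, ht, rfl⟩ := hy
      have hst : s * t = (-1 : ℤˣ) ^ (i * j) • (t * s) :=
        exterior_supercommutative _ i j s hs t ht
      rw [Algebra.TensorProduct.tmul_mul_tmul, Algebra.TensorProduct.tmul_mul_tmul, hst, mul_comm f]
      rcases Int.units_eq_one_or ((-1 : ℤˣ) ^ (i * j)) with h | h <;> rw [h]
      · simp
      · simp [TensorProduct.tmul_neg]
    | zero => simp
    | add x y _ _ ihx ihy => rw [mul_add, add_mul, smul_add, ihx, ihy]
    | smul c x _ ih => rw [mul_smul_comm, smul_mul_assoc, ih, smul_comm]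
  | zero => simp
  | add x y _ _ ihx ihy => rw [mul_add, add_mul, smul_add, ihx, ihy]
  | smul c x _ ih => rw [mul_smul_comm, smul_mul_assoc, ih, smul_comm]

end Model

/-! ### Supermanifolds -/

/-- The algebra of sections `F(U)` of a sheaf of `ℝ`-algebras. -/
def Sections {X : TopCat.{u}} (F : TopCat.Sheaf (AlgCat.{u} ℝ) X) (U : Opens X) : Type u :=
  F.presheaf.obj (op U)

instance {X : TopCat.{u}} (F : TopCat.Sheaf (AlgCat.{u} ℝ) X) (U : Opens X) :
    Ring (Sections F U) :=
  (F.presheaf.obj (op U)).isRing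

instance {X : TopCat.{u}} (F : TopCat.Sheaf (AlgCat.{u} ℝ) X) (U : Opens X) :
    Algebra ℝ (Sections F U) :=
  (F.presheaf.obj (op U)).isAlgebra

/-- The restriction `F(U) → F(V)`. -/
def sectionsRes {X : TopCat.{u}} (F : TopCat.Sheaf (AlgCat.{u} ℝ) X) {U V : Opens X} (h : V ≤ U) :
    Sections F U →ₐ[ℝ] Sections F V :=
  (F.presheaf.map (homOfLE h).op).hom

/-- A topological space with a sheaf of super `ℝ`-algebras with unity. -/
structure SuperRingedSpace where
  /-- the underlying topological space -/
  carrier : TopCat.{u}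
  /-- the structure sheaf -/
  sheaf : TopCat.Sheaf (AlgCat.{u} ℝ) carrier
  /-- the even and odd sections -/
  parity : ∀ U : Opens carrier, ZMod 2 → Submodule ℝ (Sections sheaf U)
  graded : ∀ U : Opens carrier, GradedAlgebra (parity U)
  map_parity : ∀ {U V : Opens carrier} (h : V ≤ U) (i : ZMod 2), ∀ f ∈ parity U i,
    sectionsRes sheaf h f ∈ parity V i

namespace SuperRingedSpace

variable (S : SuperRingedSpace.{u})

/-- The superalgebra `𝒪(U)`. -/
abbrev Fun (U : Opens S.carrier) : Type u := Sections S.sheaf U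

instance (U : Opens S.carrier) : GradedAlgebra (S.parity U) := S.graded U

variable {S}

/-- Restriction `𝒪(U) → 𝒪(V)` of superfunctions. -/
abbrev res {U V : Opens S.carrier} (h : V ≤ U) : S.Fun U →ₐ[ℝ] S.Fun V :=
  sectionsRes S.sheaf h

theorem eq_of_res_eq {ι : Type u} {U : Opens S.carrier} (V : ι → Opens S.carrier)
    (hV : ∀ i, V i ≤ U) (hcover : U ≤ iSup V) (f g : S.Fun U)
    (h : ∀ i, res (hV i) f = res (hV i) g) : f = g :=
  S.sheaf.eq_of_locally_eq' V U (fun i => homOfLE (hV i)) hcover f g h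

end SuperRingedSpace

/-- The open set `e⁻¹(V)`. -/
def chartPreimage {X E : Type*} [TopologicalSpace X] [TopologicalSpace E]
    (e : OpenPartialHomeomorph X E) (V : Opens E) : Opens X :=
  ⟨e.source ∩ e ⁻¹' V, e.isOpen_inter_preimage V.2⟩

theorem chartPreimage_mono {X E : Type*} [TopologicalSpace X] [TopologicalSpace E]
    (e : OpenPartialHomeomorph X E) {V W : Opens E} (h : W ≤ V) :
    chartPreimage e W ≤ chartPreimage e V :=
  fun _ hx => ⟨hx.1, h hx.2⟩

/-- An isomorphism of super ringed spaces from an open part of `S` onto an open part of `ℝ^{n|m}`: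
a homeomorphism `e` from an open subset of `S` onto an open subset of `ℝⁿ`, and an isomorphism of
sheaves of superalgebras between the direct image of the structure sheaf of `S` under `e` and
`C^∞ ⊗ Λ[ξ₁, …, ξₘ]`. -/
structure SuperChart (n m : ℕ) (S : SuperRingedSpace.{u}) where
  e : OpenPartialHomeomorph S.carrier (EuclideanSpace ℝ (Fin n))
  iso : ∀ V : Opens (EuclideanSpace ℝ (Fin n)), (V : Set (EuclideanSpace ℝ (Fin n))) ⊆ e.target →
    (S.Fun (chartPreimage e V) ≃ₐ[ℝ] Model m V)
  iso_parity : ∀ V hV (i : ZMod 2) (f : S.Fun (chartPreimage e V)),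
    f ∈ S.parity (chartPreimage e V) i ↔ iso V hV f ∈ modelParity m V i
  iso_res : ∀ V hV W hW (h : W ≤ V) (f : S.Fun (chartPreimage e V)),
    iso W hW (SuperRingedSpace.res (chartPreimage_mono e h) f) = modelRes m h (iso V hV f)

/-- A supermanifold of dimension `n|m`. -/
structure Supermanifold (n m : ℕ) extends SuperRingedSpace.{u} where
  t2 : T2Space carrier
  secondCountable : SecondCountableTopology carrier
  exists_chart : ∀ p : carrier, ∃ c : SuperChart n m toSuperRingedSpace, p ∈ c.e.source

namespace Supermanifold

variable {n m : ℕ} (M : Supermanifold.{u} n m)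

/-- The structure sheaf of a supermanifold is supercommutative, since that of `ℝ^{n|m}` is. -/
theorem supercommutative (U : Opens M.carrier) : IsSupercommutative (M.parity U) := by
  intro i j f hf g hg
  choose c hc using M.exists_chart
  let V : U → Opens (EuclideanSpace ℝ (Fin n)) := fun p =>
    ⟨(c p).e.target ∩ (c p).e.symm ⁻¹' U, (c p).e.isOpen_inter_preimage_symm U.2⟩
  have hVt : ∀ p : U, (V p : Set (EuclideanSpace ℝ (Fin n))) ⊆ (c p).e.target :=
    fun p => Set.inter_subset_left
  have hVU : ∀ p : U, chartPreimage (c p).e (V p) ≤ U := by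
    rintro p x ⟨hx, -, hx'⟩
    rwa [Set.mem_preimage, (c p).e.left_inv hx] at hx'
  refine SuperRingedSpace.eq_of_res_eq (fun p : U => chartPreimage (c p.1).e (V p)) hVU ?_ _ _ ?_
  · intro p hp
    refine Opens.mem_iSup.2 ⟨⟨p, hp⟩, hc p, (c p).e.map_source (hc p), ?_⟩
    rw [Set.mem_preimage, (c p).e.left_inv (hc p)]
    exact hp
  · intro p
    apply ((c p).iso (V p) (hVt p)).injective
    have key := model_supercommutative m (V p) i j _
      (((c p).iso_parity (V p) (hVt p) i _).1 (M.map_parity (hVU p) i f hf)) _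
      (((c p).iso_parity (V p) (hVt p) j _).1 (M.map_parity (hVU p) j g hg))
    rw [Units.smul_def] at key ⊢
    rw [map_mul, map_zsmul, map_zsmul, map_mul, map_mul, map_mul]
    exact key

/-- The vector fields on `U`, i.e. the derivations of `𝒪(U)`, as an `𝒪(U)`-module. -/
abbrev VectorField (U : Opens M.carrier) : Type u :=
  Der (M.parity U) (M.supercommutative U)

variable {M}

/-- `X` is homogeneous of parity `i`. -/
def IsHom {U : Opens M.carrier} (i : ZMod 2) (X : M.VectorField U) : Prop :=
  X.1 ∈ homDer (M.parity U) i

/-- The homogeneous component of parity `i` of a vector field. -/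
def part {U : Opens M.carrier} (i : ZMod 2) (X : M.VectorField U) : M.VectorField U :=
  ⟨endPart (M.parity U) i X.1, homDer_le_der _ _ (X.2 i)⟩

/-- The bracket of vector fields: the bilinear extension of
`[X, Y] = X ∘ Y - (-1)^{|X||Y|} Y ∘ X` for homogeneous `X`, `Y`. -/
def bracket {U : Opens M.carrier} (X Y : M.VectorField U) : M.VectorField U :=
  ⟨∑ i : ZMod 2, ∑ j : ZMod 2, ((part i X).1 * (part j Y).1 -
      (-1 : ℤˣ) ^ (i * j) • ((part j Y).1 * (part i X).1)),
    sum_mem fun i _ => sum_mem fun j _ =>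
      homDer_le_der _ _ (superCommutator_mem _ (X.2 i) (Y.2 j))⟩

/-- The vector field `X'` on `V` is the restriction of the vector field `X` on `U`: it is the
derivation of `𝒪(V)` with `X' (f|_V) = (X f)|_V` (on a supermanifold there is exactly one). -/
def IsRestriction {U V : Opens M.carrier} (h : V ≤ U) (X : M.VectorField U)
    (X' : M.VectorField V) : Prop :=
  ∀ f : M.Fun U, X'.1 (SuperRingedSpace.res h f) = SuperRingedSpace.res h (X.1 f)

variable (M)

/-- The sections over `U` of the cotangent sheaf, the dual of the tangent sheaf: morphisms
of sheaves of `𝒪`-modules from the tangent sheaf on `U` to the structure sheaf on `U`. -/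
structure Covector (U : Opens M.carrier) where
  app : ∀ V : Opens M.carrier, V ≤ U → M.VectorField V →ₗ[M.Fun V] M.Fun V
  app_res : ∀ V hV W hW (h : W ≤ V) (X : M.VectorField V) (X' : M.VectorField W),
    IsRestriction h X X' → app W hW X' = SuperRingedSpace.res h (app V hV X)

/-- A graded Riemannian metric: an even, graded-symmetric, non-degenerate `𝒪`-bilinear pairing
of the tangent sheaf with values in the structure sheaf. -/
structure GradedMetric where
  inner : ∀ U : Opens M.carrier, M.VectorField U →ₗ[M.Fun U] M.VectorField U →ₗ[ℝ] M.Fun U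
  inner_smul_right : ∀ U (i j : ZMod 2) (X Y : M.VectorField U) (f : M.Fun U),
    IsHom i X → f ∈ M.parity U j →
      inner U X (f • Y) = (-1 : ℤˣ) ^ (i * j) • (f * inner U X Y)
  inner_res : ∀ {U V : Opens M.carrier} (h : V ≤ U) (X Y : M.VectorField U)
    (X' Y' : M.VectorField V), IsRestriction h X X' → IsRestriction h Y Y' →
      inner V X' Y' = SuperRingedSpace.res h (inner U X Y)
  even : ∀ U (i j : ZMod 2) (X Y : M.VectorField U), IsHom i X → IsHom j Y →
    inner U X Y ∈ M.parity U (i + j)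
  symm : ∀ U (i j : ZMod 2) (X Y : M.VectorField U), IsHom i X → IsHom j Y →
    inner U X Y = (-1 : ℤˣ) ^ (i * j) • inner U Y X
  /-- The map from vector fields to covectors that the pairing induces is an isomorphism. As
  covectors are `𝒪`-linear from the left, the covector of `X` is
  `Y ↦ ⟨Y, X⟩ = (-1)^{|X||Y|} ⟨X, Y⟩`. -/
  nondegenerate : ∀ U (c : M.Covector U), ∃! X : M.VectorField U,
    ∀ V (hV : V ≤ U) (X' : M.VectorField V), IsRestriction hV X X' →
      ∀ Y : M.VectorField V, c.app V hV Y = inner V Y X'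

/-- A connection on `M`, given by its covariant derivatives `∇_X Y`: an even morphism of sheaves,
`𝒪`-linear in `X`, that satisfies the graded Leibniz rule in `Y`. -/
structure Connection where
  cov : ∀ U : Opens M.carrier, M.VectorField U →ₗ[M.Fun U] M.VectorField U →ₗ[ℝ] M.VectorField U
  leibniz : ∀ U (i j : ZMod 2) (X Y : M.VectorField U) (f : M.Fun U),
    IsHom i X → f ∈ M.parity U j →
      cov U X (f • Y) = X.1 f • Y + (-1 : ℤˣ) ^ (i * j) • (f • cov U X Y)
  even : ∀ U (i j : ZMod 2) (X Y : M.VectorField U), IsHom i X → IsHom j Y →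
    IsHom (i + j) (cov U X Y)
  cov_res : ∀ {U V : Opens M.carrier} (h : V ≤ U) (X Y : M.VectorField U)
    (X' Y' : M.VectorField V), IsRestriction h X X' → IsRestriction h Y Y' →
      IsRestriction h (cov U X Y) (cov V X' Y')

variable {M}

namespace Connection

variable (C : M.Connection) {U : Opens M.carrier}

/-- The torsion: the bilinear extension of
`T(X, Y) = ∇_X Y - (-1)^{|X||Y|} ∇_Y X - [X, Y]` for homogeneous `X`, `Y`. -/
def torsion (X Y : M.VectorField U) : M.VectorField U :=
  ∑ i : ZMod 2, ∑ j : ZMod 2, (C.cov U (part i X) (part j Y) -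
    (-1 : ℤˣ) ^ (i * j) • C.cov U (part j Y) (part i X)) - bracket X Y

/-- The curvature `R(X, Y) Z = [∇_X, ∇_Y] Z - ∇_{[X, Y]} Z`, where `[∇_X, ∇_Y]` is the bilinear
extension of `∇_X ∇_Y - (-1)^{|X||Y|} ∇_Y ∇_X` for homogeneous `X`, `Y`. -/
def curvature (X Y Z : M.VectorField U) : M.VectorField U :=
  ∑ i : ZMod 2, ∑ j : ZMod 2, (C.cov U (part i X) (C.cov U (part j Y) Z) -
    (-1 : ℤˣ) ^ (i * j) • C.cov U (part j Y) (C.cov U (part i X) Z)) - C.cov U (bracket X Y) Z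

/-- `X⟨Y, Z⟩ = ⟨∇_X Y, Z⟩ + (-1)^{|X||Y|} ⟨Y, ∇_X Z⟩`. -/
def IsMetric (g : M.GradedMetric) : Prop :=
  ∀ (U : Opens M.carrier) (i j : ZMod 2) (X Y Z : M.VectorField U), IsHom i X → IsHom j Y →
    X.1 (g.inner U Y Z) =
      g.inner U (C.cov U X Y) Z + (-1 : ℤˣ) ^ (i * j) • g.inner U Y (C.cov U X Z)

/-- The Levi-Civita connection of `g` is the torsionless metric connection. -/
structure IsLeviCivita (g : M.GradedMetric) : Prop where
  torsionless : ∀ (U : Opens M.carrier) (X Y : M.VectorField U), C.torsion X Y = 0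
  metric : C.IsMetric g

end Connection

end Supermanifold

end SuperGeometry

end

open SuperGeometry SuperGeometry.Supermanifold

/-!
The curvature symmetries are formal consequences of the two defining properties of `∇`, just as in
the ungraded case; only the signs need care.

* Antisymmetry in `X, Y` is antisymmetry of the bracket (`curvature_swap`).
* Antisymmetry in `Z, W`: since `[X, Y]` is the supercommutator of `X` and `Y` as operators on
  functions, differentiating `⟨Z, W⟩` along `X` and `Y` in both orders and using that `∇` is metric
  shows that `R(X, Y)` is a skew operator (`inner_curvature_add`); graded symmetry of the metric
  then moves `Z` to the second slot.
* The Bianchi identity: vanishing torsion turns the cyclic sum of `R(X, Y) Z` into the cyclic sum of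
  `[X, [Y, Z]]`, which vanishes by the super Jacobi identity (`bracket_jacobi`).
* Pair symmetry: the signed sum of the four Bianchi identities obtained by leaving out one of
  `X, Y, Z, W` collapses, by the two antisymmetries, to twice the difference of the two sides.

The sign identities are verified separately for each choice of parities in `ZMod 2`, where all signs
become explicit.
-/

namespace SuperGeometry

namespace Supermanifold

variable {n m : ℕ} {M : Supermanifold n m} {U : Opens M.carrier} {i j k l : ZMod 2}
  {X Y Z W : M.VectorField U}

/-! ### Homogeneous vector fields and their brackets -/

theorem part_of_isHom (hX : IsHom i X) (a : ZMod 2) : part a X = if a = i then X else 0 := by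
  refine Subtype.ext ((endPart_of_homogeneous _ hX.1 a).trans ?_)
  split_ifs <;> rfl

/-- Parity-indexed bilinear extensions, such as those that define the bracket, the torsion and the
curvature, reduce to a single term on homogeneous vector fields. -/
theorem sum_part {G : Type*} [AddCommMonoid G]
    (F : ZMod 2 → ZMod 2 → M.VectorField U → M.VectorField U → G)
    (h₁ : ∀ a b T, F a b 0 T = 0) (h₂ : ∀ a b T, F a b T 0 = 0)
    (hX : IsHom i X) (hY : IsHom j Y) :
    ∑ a : ZMod 2, ∑ b : ZMod 2, F a b (part a X) (part b Y) = F i j X Y := by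
  rw [Finset.sum_eq_single i, Finset.sum_eq_single j]
  · simp [part_of_isHom hX, part_of_isHom hY]
  · intro b _ hb
    rw [part_of_isHom hY, if_neg hb, h₂]
  · simp
  · intro a _ ha
    refine Finset.sum_eq_zero fun b _ => ?_
    rw [part_of_isHom hX, if_neg ha, h₁]
  · simp

theorem bracket_val (hX : IsHom i X) (hY : IsHom j Y) :
    (bracket X Y).1 = X.1 * Y.1 - (-1 : ℤˣ) ^ (i * j) • (Y.1 * X.1) := by
  have h0 : (0 : M.VectorField U).1 = 0 := rfl
  exact sum_part (fun a b S T => S.1 * T.1 - (-1 : ℤˣ) ^ (a * b) • (T.1 * S.1))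
    (by simp [h0]) (by simp [h0]) hX hY

theorem isHom_bracket (hX : IsHom i X) (hY : IsHom j Y) : IsHom (i + j) (bracket X Y) := by
  rw [IsHom, bracket_val hX hY]
  exact superCommutator_mem _ hX hY

theorem bracket_swap (hX : IsHom i X) (hY : IsHom j Y) :
    bracket X Y = -((-1 : ℤˣ) ^ (i * j) • bracket Y X) := by
  have hneg : ∀ T : M.VectorField U, (-T).1 = -T.1 := fun _ => rfl
  apply Subtype.ext
  rcases zmod_two_cases i with rfl | rfl <;> rcases zmod_two_cases j with rfl | rfl <;>
    simp [hneg, bracket_val hX hY, bracket_val hY hX] <;> abel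

/-- The super Jacobi identity. -/
theorem bracket_jacobi (hX : IsHom i X) (hY : IsHom j Y) (hZ : IsHom k Z) :
    bracket X (bracket Y Z) + (-1 : ℤˣ) ^ (i * (j + k)) • bracket Y (bracket Z X) +
      (-1 : ℤˣ) ^ (k * (i + j)) • bracket Z (bracket X Y) = 0 := by
  have hneg : ∀ T : M.VectorField U, (-T).1 = -T.1 := fun _ => rfl
  have hadd : ∀ S T : M.VectorField U, (S + T).1 = S.1 + T.1 := fun _ _ => rfl
  have h0 : (0 : M.VectorField U).1 = 0 := rfl
  have e11 : (1 + 1 : ZMod 2) = 0 := rfl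
  have h₁ := bracket_val hX (isHom_bracket hY hZ)
  have h₂ := bracket_val hY (isHom_bracket hZ hX)
  have h₃ := bracket_val hZ (isHom_bracket hX hY)
  rw [bracket_val hY hZ] at h₁
  rw [bracket_val hZ hX] at h₂
  rw [bracket_val hX hY] at h₃
  apply Subtype.ext
  rcases zmod_two_cases i with rfl | rfl <;> rcases zmod_two_cases j with rfl | rfl <;>
    rcases zmod_two_cases k with rfl | rfl <;>
    simp [e11] at h₁ h₂ h₃ <;>
    simp only [e11, hneg, hadd, h0, h₁, h₂, h₃, mul_zero, mul_one, zero_add, add_zero, uzpow_zero,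
      uzpow_one, one_smul, Units.neg_smul, mul_add, mul_sub, add_mul, sub_mul, mul_assoc] <;> abel

/-! ### Curvature of a connection -/

namespace Connection

variable {C : M.Connection} {g : M.GradedMetric}

theorem curvature_eq (hX : IsHom i X) (hY : IsHom j Y) (Z : M.VectorField U) :
    C.curvature X Y Z = C.cov U X (C.cov U Y Z) -
      (-1 : ℤˣ) ^ (i * j) • C.cov U Y (C.cov U X Z) - C.cov U (bracket X Y) Z := by
  rw [curvature, sum_part (fun a b S T => C.cov U S (C.cov U T Z) -
    (-1 : ℤˣ) ^ (a * b) • C.cov U T (C.cov U S Z)) (by simp) (by simp) hX hY]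

theorem torsion_eq (hX : IsHom i X) (hY : IsHom j Y) :
    C.torsion X Y = C.cov U X Y - (-1 : ℤˣ) ^ (i * j) • C.cov U Y X - bracket X Y := by
  rw [torsion, sum_part (fun a b S T => C.cov U S T -
    (-1 : ℤˣ) ^ (a * b) • C.cov U T S) (by simp) (by simp) hX hY]

theorem isHom_curvature (hX : IsHom i X) (hY : IsHom j Y) (hZ : IsHom k Z) :
    IsHom (i + j + k) (C.curvature X Y Z) := by
  rw [curvature_eq hX hY, IsHom]
  have h₁ := C.even U _ _ _ _ hX (C.even U _ _ _ _ hY hZ)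
  have h₂ := C.even U _ _ _ _ hY (C.even U _ _ _ _ hX hZ)
  have h₃ := C.even U _ _ _ _ (isHom_bracket hX hY) hZ
  rw [← add_assoc] at h₁
  rw [← add_assoc, add_comm j i] at h₂
  exact sub_mem (sub_mem h₁ (zsmul_mem h₂ (((-1 : ℤˣ) ^ (i * j) : ℤˣ) : ℤ))) h₃

theorem curvature_swap (hX : IsHom i X) (hY : IsHom j Y) (Z : M.VectorField U) :
    C.curvature X Y Z = -((-1 : ℤˣ) ^ (i * j) • C.curvature Y X Z) := by
  rw [curvature_eq hX hY, curvature_eq hY hX, bracket_swap hX hY]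
  rcases zmod_two_cases i with rfl | rfl <;> rcases zmod_two_cases j with rfl | rfl <;>
    simp <;> abel

/-- The first Bianchi identity of a torsionless connection. -/
theorem curvature_bianchi (hC : ∀ S T : M.VectorField U, C.torsion S T = 0)
    (hX : IsHom i X) (hY : IsHom j Y) (hZ : IsHom k Z) :
    C.curvature X Y Z + (-1 : ℤˣ) ^ (k * (i + j)) • C.curvature Z X Y +
      (-1 : ℤˣ) ^ (i * (j + k)) • C.curvature Y Z X = 0 := by
  have e11 : (1 + 1 : ZMod 2) = 0 := rfl
  have tor : ∀ {a b : ZMod 2} {S T : M.VectorField U}, IsHom a S → IsHom b T →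
      C.cov U S T - (-1 : ℤˣ) ^ (a * b) • C.cov U T S - bracket S T = 0 :=
    fun hS hT => (torsion_eq hS hT).symm.trans (hC _ _)
  have a₁ := congrArg (C.cov U X) (tor hY hZ)
  have a₂ := congrArg (C.cov U Y) (tor hZ hX)
  have a₃ := congrArg (C.cov U Z) (tor hX hY)
  have b₁ := tor hX (isHom_bracket hY hZ)
  have b₂ := tor hY (isHom_bracket hZ hX)
  have b₃ := tor hZ (isHom_bracket hX hY)
  have J := bracket_jacobi hX hY hZ
  rw [curvature_eq hX hY, curvature_eq hZ hX, curvature_eq hY hZ]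
  -- By `a₁`, the terms that start with `∇_X` add up to `∇_X [Y, Z]`; by `b₁`, this and the term
  -- `∇_{[Y, Z]} X` leave `[X, [Y, Z]]`. The same holds cyclically, and `J` closes the sum.
  have key := congrArg₂ (· + ·) (congrArg₂ (· + ·)
    (congrArg₂ (· + ·) (congrArg₂ (· + ·) a₁ (congrArg ((-1 : ℤˣ) ^ (i * (j + k)) • ·) a₂))
      (congrArg ((-1 : ℤˣ) ^ (k * (i + j)) • ·) a₃))
    (congrArg₂ (· + ·) (congrArg₂ (· + ·) b₁ (congrArg ((-1 : ℤˣ) ^ (i * (j + k)) • ·) b₂))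
      (congrArg ((-1 : ℤˣ) ^ (k * (i + j)) • ·) b₃))) J
  refine Eq.trans ?_ (key.trans (by simp))
  rcases zmod_two_cases i with rfl | rfl <;> rcases zmod_two_cases j with rfl | rfl <;>
    rcases zmod_two_cases k with rfl | rfl <;>
    simp only [e11, map_sub, map_neg, mul_zero, mul_one, zero_add, add_zero, uzpow_zero,
      uzpow_one, one_smul, Units.neg_smul] <;> abel

/-- The curvature of a metric connection acts by skew operators. -/
theorem inner_curvature_add (hC : C.IsMetric g)
    (hX : IsHom i X) (hY : IsHom j Y) (hZ : IsHom k Z) (W : M.VectorField U) :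
    g.inner U (C.curvature X Y Z) W +
      (-1 : ℤˣ) ^ ((i + j) * k) • g.inner U Z (C.curvature X Y W) = 0 := by
  have e11 : (1 + 1 : ZMod 2) = 0 := rfl
  have met : ∀ {a b : ZMod 2} {S T : M.VectorField U} (V : M.VectorField U), IsHom a S →
      IsHom b T → S.1 (g.inner U T V) - g.inner U (C.cov U S T) V -
        (-1 : ℤˣ) ^ (a * b) • g.inner U T (C.cov U S V) = 0 := fun V hS hT => by
    rw [hC U _ _ _ _ V hS hT]
    abel
  have hB := met W (isHom_bracket hX hY) hZ
  have hXY := congrArg X.1 (met W hY hZ)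
  have hYX := congrArg Y.1 (met W hX hZ)
  have x₁ := met W hX (C.even U _ _ _ _ hY hZ)
  have x₂ := met (C.cov U Y W) hX hZ
  have y₁ := met W hY (C.even U _ _ _ _ hX hZ)
  have y₂ := met (C.cov U X W) hY hZ
  rw [bracket_val hX hY] at hB
  rw [curvature_eq hX hY, curvature_eq hX hY]
  -- The second derivatives of `⟨Z, W⟩` cancel because `[X, Y]` is the supercommutator.
  have key := congrArg₂ (· + ·) hB (congrArg₂ (· - ·)
    (congrArg ((-1 : ℤˣ) ^ (i * j) • ·) (congrArg₂ (· + ·) (congrArg₂ (· + ·) hYX y₁)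
      (congrArg ((-1 : ℤˣ) ^ (i * k) • ·) y₂)))
    (congrArg₂ (· + ·) (congrArg₂ (· + ·) hXY x₁) (congrArg ((-1 : ℤˣ) ^ (j * k) • ·) x₂)))
  refine Eq.trans ?_ (key.trans (by simp))
  rcases zmod_two_cases i with rfl | rfl <;> rcases zmod_two_cases j with rfl | rfl <;>
    rcases zmod_two_cases k with rfl | rfl <;>
    simp only [e11, map_sub, map_neg, mul_zero, mul_one, zero_add, add_zero,
      uzpow_zero, uzpow_one, one_smul, Units.neg_smul, LinearMap.sub_apply,
      LinearMap.neg_apply, Module.End.mul_apply] <;> abel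

theorem inner_curvature_swap (hC : C.IsMetric g)
    (hX : IsHom i X) (hY : IsHom j Y) (hZ : IsHom k Z) (hW : IsHom l W) :
    g.inner U (C.curvature X Y Z) W =
      -((-1 : ℤˣ) ^ (k * l) • g.inner U (C.curvature X Y W) Z) := by
  rw [eq_neg_of_add_eq_zero_left (inner_curvature_add hC hX hY hZ W),
    g.symm U _ _ _ _ hZ (isHom_curvature hX hY hW), smul_smul, ← uzpow_add]
  congr 3
  linear_combination CharTwo.add_self_eq_zero (k * (i + j))

theorem inner_curvature_swap_left (hX : IsHom i X) (hY : IsHom j Y) (Z W : M.VectorField U) :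
    g.inner U (C.curvature X Y Z) W =
      -((-1 : ℤˣ) ^ (i * j) • g.inner U (C.curvature Y X Z) W) := by
  rw [curvature_swap hX hY]
  rcases Int.units_eq_one_or ((-1 : ℤˣ) ^ (i * j)) with h | h <;> simp [h]

theorem inner_curvature_bianchi (hC : ∀ S T : M.VectorField U, C.torsion S T = 0)
    (hX : IsHom i X) (hY : IsHom j Y) (hZ : IsHom k Z) (W : M.VectorField U) :
    g.inner U (C.curvature X Y Z) W +
      (-1 : ℤˣ) ^ (k * (i + j)) • g.inner U (C.curvature Z X Y) W +
      (-1 : ℤˣ) ^ (i * (j + k)) • g.inner U (C.curvature Y Z X) W = 0 := by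
  have h := congrArg (fun T => g.inner U T W) (curvature_bianchi hC hX hY hZ)
  rcases Int.units_eq_one_or ((-1 : ℤˣ) ^ (k * (i + j))) with h₁ | h₁ <;>
    rcases Int.units_eq_one_or ((-1 : ℤˣ) ^ (i * (j + k))) with h₂ | h₂ <;>
    simpa [h₁, h₂] using h

/-- The four Bianchi identities involve, up to antisymmetry, six curvature terms; the alternating
sum taken here cancels all but the two terms compared, each of which occurs twice. -/
theorem inner_curvature_pair_swap (hC : C.IsLeviCivita g)
    (hX : IsHom i X) (hY : IsHom j Y) (hZ : IsHom k Z) (hW : IsHom l W) :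
    g.inner U (C.curvature X Y Z) W =
      (-1 : ℤˣ) ^ ((i + j) * (k + l)) • g.inner U (C.curvature Z W X) Y := by
  have e11 : (1 + 1 : ZMod 2) = 0 := rfl
  have b₁ := inner_curvature_bianchi (g := g) (hC.torsionless U) hX hY hZ W
  have b₂ := inner_curvature_bianchi (g := g) (hC.torsionless U) hX hY hW Z
  have b₃ := inner_curvature_bianchi (g := g) (hC.torsionless U) hX hZ hW Y
  have b₄ := inner_curvature_bianchi (g := g) (hC.torsionless U) hY hZ hW X
  -- Both antisymmetries bring each pair of arguments into the order `X, Y, Z, W`.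
  rw [inner_curvature_swap_left hZ hX] at b₁
  rw [inner_curvature_swap_left hW hX, inner_curvature_swap hC.metric hX hY hW hZ] at b₂
  rw [inner_curvature_swap_left hW hX, inner_curvature_swap hC.metric hX hZ hW hY,
    inner_curvature_swap hC.metric hX hW hZ hY] at b₃
  rw [inner_curvature_swap_left hW hY, inner_curvature_swap hC.metric hY hZ hW hX,
    inner_curvature_swap hC.metric hY hW hZ hX, inner_curvature_swap hC.metric hZ hW hY hX] at b₄
  -- Each identity carries the Koszul sign of moving its omitted vector field from its place in
  -- `X, Y, Z, W` to the end; the signs `+, -, -, +` between them are those of the ungraded argument.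
  have key := congrArg₂ (· + ·) (congrArg₂ (· - ·) (congrArg₂ (· - ·) b₁
    (congrArg ((-1 : ℤˣ) ^ (k * l) • ·) b₂)) (congrArg ((-1 : ℤˣ) ^ (j * (k + l)) • ·) b₃))
    (congrArg ((-1 : ℤˣ) ^ (i * (j + k + l)) • ·) b₄)
  rw [← sub_eq_zero]
  refine (smul_eq_zero_iff_right (two_ne_zero (α := ℝ))).1 ?_
  rw [two_smul]
  refine Eq.trans ?_ (key.trans (by simp))
  clear key b₁ b₂ b₃ b₄
  rcases zmod_two_cases i with rfl | rfl <;> rcases zmod_two_cases j with rfl | rfl <;>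
    rcases zmod_two_cases k with rfl | rfl <;> rcases zmod_two_cases l with rfl | rfl <;>
    simp only [e11, mul_zero, mul_one, zero_add, add_zero, uzpow_zero, uzpow_one,
      one_smul, Units.neg_smul] <;> abel

end Connection

end Supermanifold

end SuperGeometry

theorem mainTheorem11 {n m : ℕ} (M : Supermanifold n m) (g : M.GradedMetric)
    (C : M.Connection) (hC : C.IsLeviCivita g) (U : Opens M.carrier) (i j k l : ZMod 2)
    (X Y Z W : M.VectorField U)
    (hX : IsHom i X) (hY : IsHom j Y) (hZ : IsHom k Z) (hW : IsHom l W) :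
    (g.inner U (C.curvature X Y Z) W =
        -((-1 : ℤˣ) ^ (i * j) • g.inner U (C.curvature Y X Z) W) ∧
      g.inner U (C.curvature X Y Z) W =
        -((-1 : ℤˣ) ^ (k * l) • g.inner U (C.curvature X Y W) Z)) ∧
    g.inner U (C.curvature X Y Z) W =
      (-1 : ℤˣ) ^ ((i + j) * (k + l)) • g.inner U (C.curvature Z W X) Y ∧
    C.curvature X Y Z + (-1 : ℤˣ) ^ (k * (i + j)) • C.curvature Z X Y +
      (-1 : ℤˣ) ^ (i * (j + k)) • C.curvature Y Z X = 0 :=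
  ⟨⟨Connection.inner_curvature_swap_left hX hY Z W,
      Connection.inner_curvature_swap hC.metric hX hY hZ hW⟩,
    Connection.inner_curvature_pair_swap hC hX hY hZ hW,
    Connection.curvature_bianchi (hC.torsionless U) hX hY hZ⟩
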